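/- Let $\tau$ be an algebraic language containing at least one constant (nullary operation) symbol. A variety of type $\tau$ is a class of $\tau$-algebras closed under homomorphic images, subalgebras and direct products; for a variety $\mathcal{V}$, let $\mathbf{L}(\mathcal{V})$ be the lattice of its subvarieties, ordered by inclusion. An identity $\varphi\approx\psi$ is regular if exactly the same variables occur in $\varphi$ and in $\psi$; the regularization $R(\mathcal{V})$ is the variety of all $\tau$-algebras that satisfy every regular identity holding in $\mathcal{V}$. The variety $\mathcal{V}$ is strongly irregular if there is a binary $\tau$-term $f(x,y)$, in which both $x$ and $y$ actually occur, such that $\mathcal{V}\models f(x,y)\approx x$. Let $\mathbf{2}$ be the two-element chain $0<1$. **Theorem.** Let $\mathcal{V}$ be a strongly irregular variety of type $\tau$. Then $$\mathbf{L}(R(\mathcal{V}))\;\cong\;\mathbf{L}(\mathcal{V})\times\mathbf{2}.$$ More precisely, the map $\phi\colon \mathbf{L}(\mathcal{V})\times\mathbf{2}\to\mathbf{L}(R(\mathcal{V}))$ given by $\phi(\mathcal{W},0)=\mathcal{W}$ and $\phi(\mathcal{W},1)=R(\mathcal{W})$ is a lattice isomorphism. -/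

import Mathlib

open FirstOrder FirstOrder.Language CategoryTheory

universe u v w

namespace UniversalAlgebra

/-- The algebras of type `L`, where `L` is a first-order language without relation symbols.  The
universe is arbitrary, subject to being large enough to contain the operation symbols of `L`. -/
abbrev Alg (L : FirstOrder.Language.{u, v}) : Type (max (max u v) ((max u w) + 1)) :=
  Bundled.{max u w} L.Structure

/-- The direct product of a family of algebras, with componentwise operations. -/
instance piStructure (L : FirstOrder.Language.{u, v}) {ι : Type*} (A : ι → Type*)
    [∀ i, L.Structure (A i)] : L.Structure (∀ i, A i) where
  funMap f x := fun i => Structure.funMap f (fun k => x k i)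
  RelMap r x := ∀ i, Structure.RelMap r (fun k => x k i)

/-- A variety of algebras of type `L`: a class of algebras closed under homomorphic images,
subalgebras and direct products. -/
@[ext]
structure Variety (L : FirstOrder.Language.{u, v}) where
  carrier : Set (Alg.{u, v, w} L)
  hom_closed : ∀ A ∈ carrier, ∀ (B : Alg.{u, v, w} L) (φ : A →[L] B),
    Function.Surjective φ → B ∈ carrier
  sub_closed : ∀ A ∈ carrier, ∀ S : L.Substructure A, 
    (⟨S, Substructure.inducedStructure⟩ : Alg.{u, v, w} L) ∈ carrier
  prod_closed : ∀ (ι : Type (max u w)) (A : ι → Alg.{u, v, w} L), (∀ i, A i ∈ carrier) →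
    (⟨∀ i, A i, piStructure L fun i => A i⟩ : Alg.{u, v, w} L) ∈ carrier

/-- An identity `lhs ≈ rhs` in the variables `x₀, x₁, x₂, …`. -/
structure Identity (L : FirstOrder.Language.{u, v}) where
  lhs : L.Term ℕ
  rhs : L.Term ℕ

namespace Identity

/-- The identity `e` holds in the algebra `A`. -/
def HoldsIn {L : FirstOrder.Language.{u, v}} (e : Identity L) (A : Type*) [L.Structure A] : Prop :=
  ∀ a : ℕ → A, e.lhs.realize a = e.rhs.realize a

/-- An identity is regular if the same variables occur on both sides. -/
def IsRegular {L : FirstOrder.Language.{u, v}} (e : Identity L) : Prop :=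
  e.lhs.varFinset = e.rhs.varFinset

end Identity

theorem realize_pi {L : FirstOrder.Language.{u, v}} {ι α : Type*} (A : ι → Type*)
    [∀ i, L.Structure (A i)] (t : L.Term α) (a : α → ∀ i, A i) (i : ι) :
    t.realize a i = t.realize (fun k => a k i) := by
  induction t with
  | var k => rfl
  | func f ts ih =>
    change Structure.funMap f (fun k => (ts k).realize a i) = _
    simp only [ih, Term.realize_func]

namespace Variety

/-- Varieties are ordered by inclusion. -/
instance instPartialOrder (L : FirstOrder.Language.{u, v}) : PartialOrder (Variety.{u, v, w} L) :=
  PartialOrder.lift carrier fun _ _ h => Variety.ext h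

/-- The infimum of a family of varieties is its intersection. -/
instance instInfSet (L : FirstOrder.Language.{u, v}) : InfSet (Variety.{u, v, w} L) where
  sInf 𝒮 :=
    { carrier := {A | ∀ V ∈ 𝒮, A ∈ V.carrier}
      hom_closed := fun A hA B φ hφ V hV => V.hom_closed A (hA V hV) B φ hφ
      sub_closed := fun A hA S V hV => V.sub_closed A (hA V hV) S
      prod_closed := fun ι A hA V hV => V.prod_closed ι A fun i => hA i V hV }

/-- The complete lattice of all varieties of type `L`, ordered by inclusion. -/
instance instCompleteLattice (L : FirstOrder.Language.{u, v}) :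
    CompleteLattice (Variety.{u, v, w} L) :=
  completeLatticeOfInf _ fun _ => ⟨fun V hV _ hA => hA V hV, fun _ hW _ hA _ hV => hW hV hA⟩

/-- The lattice `L(V)` of subvarieties of `V`. -/
abbrev Subvarieties {L : FirstOrder.Language.{u, v}} (V : Variety.{u, v, w} L) :
    Type (max (max u v) ((max u w) + 1)) :=
  Set.Iic V

/-- The identity `e` holds in every member of `V`. -/
def Satisfies {L : FirstOrder.Language.{u, v}} (V : Variety.{u, v, w} L) (e : Identity L) : Prop :=
  ∀ A ∈ V.carrier, e.HoldsIn A

/-- The variety of all algebras satisfying a given set of identities. -/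
def ofIdentities {L : FirstOrder.Language.{u, v}} (E : Set (Identity L)) :
    Variety.{u, v, w} L where
  carrier := {A | ∀ e ∈ E, e.HoldsIn A}
  hom_closed := fun A hA B φ hφ e he b => by
    choose g hg using hφ
    have hb : b = φ ∘ fun n => g (b n) := funext fun n => (hg (b n)).symm
    rw [hb, HomClass.realize_term, HomClass.realize_term, hA e he]
  sub_closed := fun A hA S e he a => by
    apply S.subtype.injective
    rw [← HomClass.realize_term, ← HomClass.realize_term]
    exact hA e he _
  prod_closed := fun ι A hA e he a => by
    funext i
    have hl := realize_pi (fun i => A i) e.lhs a i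
    have hr := realize_pi (fun i => A i) e.rhs a i
    exact hl.trans ((hA i e he _).trans hr.symm)

/-- The regularization `R(V)`: the variety defined by the regular identities that hold in `V`. -/
def regularization {L : FirstOrder.Language.{u, v}} (V : Variety.{u, v, w} L) :
    Variety.{u, v, w} L :=
  ofIdentities {e | e.IsRegular ∧ V.Satisfies e}

/-- `V` is strongly irregular if there is a binary term `f(x, y)`, in which both `x` and `y` actually
occur, such that `f(x, y) ≈ x` holds in `V`. -/
def IsStronglyIrregular {L : FirstOrder.Language.{u, v}} (V : Variety.{u, v, w} L) : Prop :=
  ∃ f : L.Term (Fin 2), f.varFinset = Finset.univ ∧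
    ∀ A ∈ V.carrier, ∀ a b : A, f.realize ![a, b] = a

end Variety

end UniversalAlgebra

namespace UniversalAlgebra

/-! ### Variables and evaluation of terms. -/

section Terms

variable {L : FirstOrder.Language.{u, v}}

/-! Over f(x,y) ≈ x every identity s ≈ t amounts to the regular one f(s,t) ≈ f(t,s). So for W, W' ≤
V, W ≤ R(W') forces W ≤ W' (`mem_of_mem_regularization`). No R(W) lies in V, as it contains the
two-element semilattice. Hence the map is an order embedding.

For surjectivity, let U ≤ R(V). An irregular identity of U yields f(x,y) ≈ x, so U ≤ V. Otherwise U
has only regular identities, and U = R(U ⊓ V): by Birkhoff's theorem R(U ⊓ V) ≤ U; conversely each A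
in U is controlled by its Płonka fibers. These are homomorphic images of subalgebras of A, so they
lie in U, and they satisfy f(x,y) ≈ x, so they lie in V. Regular identities pass from the fibers to
A (`holdsIn_of_fibers`). -/

theorem mem_varFinset_func {α : Type*} [DecidableEq α] {n : ℕ} (F : L.Functions n)
    (ts : Fin n → L.Term α) (x : α) :
    x ∈ (Term.func F ts).varFinset ↔ ∃ i, x ∈ (ts i).varFinset := by
  simp [Term.varFinset]

theorem mem_varFinset_var {α : Type*} [DecidableEq α] (y x : α) :
    x ∈ (Term.var y : L.Term α).varFinset ↔ x = y := by
  simp [Term.varFinset]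

theorem realize_eq_of_eqOn {α : Type*} [DecidableEq α] {B : Type*} [L.Structure B]
    (t : L.Term α) {v v' : α → B} (h : ∀ x ∈ t.varFinset, v x = v' x) :
    t.realize v = t.realize v' := by
  induction t with
  | var x => exact h x (by simp [Term.varFinset])
  | func F ts ih =>
    simp only [Term.realize_func]
    congr 1
    funext i
    exact ih i fun x hx => h x ((mem_varFinset_func F ts x).2 ⟨i, hx⟩)

theorem mem_varFinset_subst {α β : Type*} [DecidableEq α] [DecidableEq β] (t : L.Term α)
    (g : α → L.Term β) (x : β) :
    x ∈ (t.subst g).varFinset ↔ ∃ y ∈ t.varFinset, x ∈ (g y).varFinset := by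
  induction t with
  | var y => simp [Term.subst]
  | func F ts ih =>
    simp only [Term.subst, mem_varFinset_func, ih]
    constructor
    · rintro ⟨i, y, hy, hx⟩
      exact ⟨y, ⟨i, hy⟩, hx⟩
    · rintro ⟨y, ⟨i, hy⟩, hx⟩
      exact ⟨i, y, hy, hx⟩

theorem mem_varFinset_relabel {α β : Type*} [DecidableEq α] [DecidableEq β] (t : L.Term α)
    (g : α → β) (x : β) :
    x ∈ (t.relabel g).varFinset ↔ ∃ y ∈ t.varFinset, x = g y := by
  induction t with
  | var y => simp [Term.relabel]
  | func F ts ih =>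
    simp only [Term.relabel, mem_varFinset_func, ih]
    constructor
    · rintro ⟨i, y, hy, hx⟩
      exact ⟨y, ⟨i, hy⟩, hx⟩
    · rintro ⟨y, ⟨i, hy⟩, hx⟩
      exact ⟨i, y, hy, hx⟩

/-- The term obtained by substituting two terms into a binary term. -/
def binary {α : Type*} (f : L.Term (Fin 2)) (s t : L.Term α) : L.Term α :=
  f.subst ![s, t]

theorem mem_varFinset_binary {α : Type*} [DecidableEq α] {f : L.Term (Fin 2)}
    (hf : f.varFinset = Finset.univ) (s t : L.Term α) (x : α) :
    x ∈ (binary f s t).varFinset ↔ x ∈ s.varFinset ∨ x ∈ t.varFinset := by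
  simp [binary, mem_varFinset_subst, hf, Fin.exists_fin_two]

theorem realize_binary {α B : Type*} [L.Structure B] (f : L.Term (Fin 2)) (s t : L.Term α)
    (v : α → B) :
    (binary f s t).realize v = f.realize ![s.realize v, t.realize v] := by
  rw [binary, Term.realize_subst]
  congr 1
  funext i
  fin_cases i <;> rfl

/-- An equation in arbitrary variables is equivalent to an identity in the variables `ℕ`. -/
theorem exists_identity {α : Type*} [DecidableEq α] [Nonempty α] (s t : L.Term α) :
    ∃ e : Identity L, (s.varFinset = t.varFinset → e.IsRegular) ∧
      ∀ (B : Type w) [L.Structure B],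
        e.HoldsIn B ↔ ∀ v : α → B, s.realize v = t.realize v := by
  obtain ⟨g, hg⟩ : ∃ g : α → ℕ, Set.InjOn g (s.varFinset ∪ t.varFinset : Finset α) :=
    Set.countable_iff_exists_injOn.1 (s.varFinset ∪ t.varFinset).countable_toSet
  refine ⟨⟨s.relabel g, t.relabel g⟩, fun h => ?_, fun B _ => ?_⟩
  · ext x
    simp only [mem_varFinset_relabel, h]
  · simp only [Identity.HoldsIn, Term.realize_relabel]
    refine ⟨fun h v => ?_, fun h a => h _⟩
    -- A valuation of `α` is pulled back along a left inverse of `g`; its values off the image of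
    -- the occurring variables are irrelevant.
    have key := h (v ∘ Function.invFunOn g (s.varFinset ∪ t.varFinset : Finset α))
    have inv : ∀ x ∈ s.varFinset ∪ t.varFinset,
        ((v ∘ Function.invFunOn g (s.varFinset ∪ t.varFinset : Finset α)) ∘ g) x = v x :=
      fun x hx => congrArg v (hg.leftInvOn_invFunOn hx)
    rwa [realize_eq_of_eqOn s fun x hx => inv x (Finset.mem_union_left _ hx),
      realize_eq_of_eqOn t fun x hx => inv x (Finset.mem_union_right _ hx)] at key

end Terms

namespace Variety

variable {L : FirstOrder.Language.{u, v}}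

/-- Birkhoff's theorem: an algebra satisfying all the identities of a variety belongs to it. -/
theorem mem_of_identities [L.IsAlgebraic] (W : Variety.{u, v, w} L) (A : Alg.{u, v, w} L)
    [Nonempty A] (h : ∀ e : Identity L, W.Satisfies e → e.HoldsIn A) : A ∈ W.carrier := by
  classical
  -- One separating member of `W` per refutable equation over `A` keeps the product small; the
  -- generic elements then satisfy only equations valid throughout `W`.
  let ι : Type (max u w) := {p : L.Term A × L.Term A //
    ∃ B ∈ W.carrier, ∃ v : A → B, p.1.realize v ≠ p.2.realize v}
  let B : ι → Alg.{u, v, w} L := fun p => p.2.choose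
  have hB : ∀ p, B p ∈ W.carrier := fun p => p.2.choose_spec.1
  let val : ∀ p, A → B p := fun p => p.2.choose_spec.2.choose
  have hval : ∀ p : ι, p.1.1.realize (val p) ≠ p.1.2.realize (val p) :=
    fun p => p.2.choose_spec.2.choose_spec
  let := piStructure L fun i => B i
  let gen : A → ∀ i, B i := fun a i => val i a
  have sep : ∀ s t : L.Term A, s.realize gen = t.realize gen →
      s.realize (id : A → A) = t.realize id := by
    intro s t hst
    by_contra hne
    have hex : ∃ B ∈ W.carrier, ∃ v : A → B, s.realize v ≠ t.realize v := by
      by_contra hno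
      push Not at hno
      obtain ⟨e, -, he⟩ := exists_identity.{u, v, max u w} s t
      exact hne ((he A).1 (h e fun C hC => (he C).2 (hno C hC)) id)
    let p : ι := ⟨(s, t), hex⟩
    apply hval p
    have := congrFun hst p
    rwa [realize_pi (fun i => B i), realize_pi (fun i => B i)] at this
  let S : L.Substructure (∀ i, B i) := Substructure.closure L (Set.range gen)
  have hS : ∀ x : S, ∃ t : L.Term A, t.realize gen = x := by
    intro x
    obtain ⟨t, ht⟩ := (Substructure.mem_closure_iff_exists_term).1 x.2
    refine ⟨t.relabel fun y => y.2.choose, ?_⟩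
    rw [Term.realize_relabel, ← ht]
    congr 1
    funext y
    exact y.2.choose_spec
  choose tm htm using hS
  have hSW : (⟨S, Substructure.inducedStructure⟩ : Alg.{u, v, w} L) ∈ W.carrier :=
    W.sub_closed ⟨∀ i, B i, piStructure L fun i => B i⟩ (W.prod_closed ι B hB) S
  -- The choice of representing terms is harmless, by `sep`.
  let φ : S →[L] A :=
    { toFun := fun x => (tm x).realize id
      map_fun' := fun F x => by
        change _ = ((Term.func F fun i => tm (x i)).realize id : A)
        apply sep
        rw [htm, Term.realize_func]
        simp only [htm]
        rfl
      map_rel' := fun r => isEmptyElim r }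
  refine W.hom_closed ⟨S, Substructure.inducedStructure⟩ hSW A φ fun a => ?_
  refine ⟨⟨gen a, Substructure.subset_closure ⟨a, rfl⟩⟩, ?_⟩
  exact sep _ (Term.var a) (htm _)

/-! ### Regularization and the two-element semilattice. -/

theorem le_regularization (W : Variety.{u, v, w} L) : W ≤ W.regularization :=
  fun A hA _ he => he.2 A hA

theorem regularization_mono {W W' : Variety.{u, v, w} L} (h : W ≤ W') :
    W.regularization ≤ W'.regularization :=
  fun _ hA e he => hA e ⟨he.1, fun B hB => he.2 B (h hB)⟩

/-- A regular equation that holds in `V` holds in every algebra of the regularization. -/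
theorem realize_eq_of_mem_regularization {V : Variety.{u, v, w} L} {A : Alg.{u, v, w} L}
    (hA : A ∈ V.regularization.carrier) {α : Type*} [Nonempty α] [DecidableEq α]
    {s t : L.Term α} (hst : s.varFinset = t.varFinset)
    (h : ∀ B ∈ V.carrier, ∀ v : α → B, s.realize v = t.realize v) (v : α → A) :
    s.realize v = t.realize v := by
  obtain ⟨e, hreg, he⟩ := exists_identity.{u, v, max u w} s t
  exact (he A).1 (hA e ⟨hreg hst, fun B hB => (he B).2 (h B hB)⟩) v

/-- The two-element algebra in which every operation is the conjunction of its arguments. -/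
def semilattice (L : FirstOrder.Language.{u, v}) : Alg.{u, v, w} L where
  α := ULift.{max u w} Prop
  str :=
    { funMap := fun _ x => ⟨∀ i, (x i).down⟩
      RelMap := fun _ _ => True }

/-- The truth value of an element of the two-element semilattice. -/
def semilattice.IsTop (x : semilattice.{u, v, w} L) : Prop :=
  ULift.down x

theorem realize_semilattice {α : Type*} [DecidableEq α] (t : L.Term α)
    (v : α → semilattice.{u, v, w} L) :
    semilattice.IsTop (t.realize v) ↔ ∀ x ∈ t.varFinset, semilattice.IsTop (v x) := by
  induction t with
  | var x => simp [Term.varFinset]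
  | func F ts ih =>
    change (∀ i, semilattice.IsTop ((ts i).realize v)) ↔ _
    simp only [ih, mem_varFinset_func]
    constructor
    · rintro h x ⟨i, hx⟩
      exact h i x hx
    · intro h i x hx
      exact h x ⟨i, hx⟩

theorem semilattice_mem_regularization (W : Variety.{u, v, w} L) :
    semilattice.{u, v, w} L ∈ W.regularization.carrier := by
  intro e he a
  apply ULift.ext
  apply propext
  change semilattice.IsTop _ ↔ semilattice.IsTop _
  rw [realize_semilattice, realize_semilattice, he.1]

variable {V : Variety.{u, v, w} L} {f : L.Term (Fin 2)}

/-- Since y occurs in f, f(1,0) = 0 in the semilattice, not 1. -/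
theorem semilattice_notMem (hf : f.varFinset = Finset.univ)
    (hV : ∀ A ∈ V.carrier, ∀ a b : A, f.realize ![a, b] = a) :
    semilattice.{u, v, w} L ∉ V.carrier := by
  intro h
  let top : semilattice.{u, v, w} L := ULift.up True
  let bot : semilattice.{u, v, w} L := ULift.up False
  have key : semilattice.IsTop (f.realize ![top, bot]) := by
    rw [hV _ h]
    trivial
  exact (realize_semilattice f _).1 key 1 (by simp [hf])

theorem realize_binary_of_mem
    (hV : ∀ A ∈ V.carrier, ∀ a b : A, f.realize ![a, b] = a) {α : Type*} (s t : L.Term α)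
    {B : Alg.{u, v, w} L} (hB : B ∈ V.carrier) (v : α → B) :
    (binary f s t).realize v = s.realize v := by
  rw [realize_binary, hV B hB]

/-- Over the identity `f(x, y) ≈ x`, every identity follows from regular ones. -/
theorem mem_of_mem_regularization [L.IsAlgebraic] {W : Variety.{u, v, w} L}
    (hf : f.varFinset = Finset.univ)
    (hW : ∀ A ∈ W.carrier, ∀ a b : A, f.realize ![a, b] = a)
    {A : Alg.{u, v, w} L} [Nonempty A] (hA : A ∈ W.regularization.carrier)
    (hAf : ∀ a b : A, f.realize ![a, b] = a) : A ∈ W.carrier := by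
  refine W.mem_of_identities A fun e he a => ?_
  have key := realize_eq_of_mem_regularization hA (s := binary f e.lhs e.rhs)
    (t := binary f e.rhs e.lhs)
    (by ext x; simp only [mem_varFinset_binary hf, or_comm])
    (fun B hB v => by
      rw [realize_binary_of_mem hW _ _ hB, realize_binary_of_mem hW _ _ hB]
      exact he B hB v) a
  rwa [realize_binary, realize_binary, hAf, hAf] at key

/-- A subvariety of the regularization with an irregular identity lies in `V`. -/
theorem realize_eq_left_of_irregular (hf : f.varFinset = Finset.univ)
    (hV : ∀ A ∈ V.carrier, ∀ a b : A, f.realize ![a, b] = a)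
    {A : Alg.{u, v, w} L} (hA : A ∈ V.regularization.carrier) {s t : L.Term ℕ}
    (hst : ∀ a : ℕ → A, s.realize a = t.realize a) {n : ℕ} (hs : n ∈ s.varFinset)
    (ht : n ∉ t.varFinset) (a b : A) : f.realize ![a, b] = a := by
  -- Sending `n` to y and all other variables to x gives regular identities f(x, sσ) ≈ f(x,y) and
  -- f(x, tσ) ≈ x of `V`; in `A`, sσ and tσ agree.
  let σ : ℕ → Fin 2 := fun k => if k = n then 1 else 0
  have h1 := realize_eq_of_mem_regularization hA
    (s := binary f (Term.var 0) (s.relabel σ)) (t := binary f (Term.var 0) (Term.var 1))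
    (by
      ext x
      simp only [mem_varFinset_binary hf, mem_varFinset_var, mem_varFinset_relabel]
      fin_cases x
      · simp
      · simp only [Fin.mk_one, one_ne_zero, false_or, iff_true]
        exact ⟨n, hs, by simp [σ]⟩)
    (fun B hB v => by
      rw [realize_binary_of_mem hV _ _ hB, realize_binary_of_mem hV _ _ hB]) ![a, b]
  have h2 := realize_eq_of_mem_regularization hA
    (s := binary f (Term.var 0) (t.relabel σ)) (t := Term.var 0)
    (by
      ext x
      simp only [mem_varFinset_binary hf, mem_varFinset_var, mem_varFinset_relabel]
      constructor
      · rintro (h | ⟨y, hy, rfl⟩)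
        · exact h
        · have : y ≠ n := fun h => ht (h ▸ hy)
          simp [σ, this]
      · exact Or.inl)
    (fun B hB v => realize_binary_of_mem hV _ _ hB v) ![a, b]
  simp only [realize_binary, Term.realize_relabel, Term.realize_var] at h1 h2
  rw [hst, h2] at h1
  exact h1.symm

/-! ### Płonka fibers. -/

section Fiber

variable {A : Alg.{u, v, w} L}

/-- This and the next laws are regular consequences of f(x,y) ≈ x. Elements of `A` serve as
variables, evaluated at `id`. -/
theorem realize_self (hf : f.varFinset = Finset.univ)
    (hV : ∀ A ∈ V.carrier, ∀ a b : A, f.realize ![a, b] = a)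
    (hA : A ∈ V.regularization.carrier) (x : A) : f.realize ![x, x] = x := by
  have : Nonempty A := ⟨x⟩
  classical
  have h := realize_eq_of_mem_regularization hA
    (s := binary f (Term.var x) (Term.var x)) (t := Term.var x)
    (by ext; simp [mem_varFinset_binary hf])
    (fun B hB v => by simp only [realize_binary, hV B hB]) id
  simpa only [realize_binary, Term.realize_var, id] using h

theorem realize_right_idem (hf : f.varFinset = Finset.univ)
    (hV : ∀ A ∈ V.carrier, ∀ a b : A, f.realize ![a, b] = a)
    (hA : A ∈ V.regularization.carrier) (x b : A) :
    f.realize ![f.realize ![x, b], b] = f.realize ![x, b] := by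
  have : Nonempty A := ⟨x⟩
  classical
  have h := realize_eq_of_mem_regularization hA
    (s := binary f (binary f (Term.var x) (Term.var b)) (Term.var b))
    (t := binary f (Term.var x) (Term.var b))
    (by ext; simp only [mem_varFinset_binary hf]; tauto)
    (fun B hB v => by simp only [realize_binary, hV B hB]) id
  simpa only [realize_binary, Term.realize_var, id] using h

theorem realize_absorb (hf : f.varFinset = Finset.univ)
    (hV : ∀ A ∈ V.carrier, ∀ a b : A, f.realize ![a, b] = a)
    (hA : A ∈ V.regularization.carrier) (x b : A) :
    f.realize ![b, f.realize ![x, b] ] = f.realize ![b, x] := by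
  have : Nonempty A := ⟨x⟩
  classical
  have h := realize_eq_of_mem_regularization hA
    (s := binary f (Term.var b) (binary f (Term.var x) (Term.var b)))
    (t := binary f (Term.var b) (Term.var x))
    (by ext; simp only [mem_varFinset_binary hf]; tauto)
    (fun B hB v => by simp only [realize_binary, hV B hB]) id
  simpa only [realize_binary, Term.realize_var, id] using h

theorem realize_cancel (hf : f.varFinset = Finset.univ)
    (hV : ∀ A ∈ V.carrier, ∀ a b : A, f.realize ![a, b] = a)
    (hA : A ∈ V.regularization.carrier) (x y b : A) :
    f.realize ![f.realize ![x, y], f.realize ![b, y] ] = f.realize ![x, f.realize ![b, y] ] := by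
  have : Nonempty A := ⟨x⟩
  classical
  have h := realize_eq_of_mem_regularization hA
    (s := binary f (binary f (Term.var x) (Term.var y)) (binary f (Term.var b) (Term.var y)))
    (t := binary f (Term.var x) (binary f (Term.var b) (Term.var y)))
    (by ext; simp only [mem_varFinset_binary hf]; tauto)
    (fun B hB v => by simp only [realize_binary, hV B hB]) id
  simpa only [realize_binary, Term.realize_var, id] using h

theorem realize_funMap_right (hf : f.varFinset = Finset.univ)
    (hV : ∀ A ∈ V.carrier, ∀ a b : A, f.realize ![a, b] = a)
    (hA : A ∈ V.regularization.carrier) {n : ℕ} (F : L.Functions n) (x : Fin n → A) (b : A) :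
    f.realize ![Structure.funMap F fun i => f.realize ![x i, b], b] =
      f.realize ![Structure.funMap F x, b] := by
  have : Nonempty A := ⟨b⟩
  classical
  have h := realize_eq_of_mem_regularization hA
    (s := binary f (Term.func F fun i => binary f (Term.var (x i)) (Term.var b)) (Term.var b))
    (t := binary f (Term.func F fun i => Term.var (x i)) (Term.var b))
    (by
      ext
      simp only [mem_varFinset_binary hf, mem_varFinset_func, exists_or]
      grind)
    (fun B hB v => by simp only [realize_binary, hV B hB, Term.realize_func]) id
  simpa only [realize_binary, Term.realize_var, Term.realize_func, id] using h

theorem realize_funMap_left (hf : f.varFinset = Finset.univ)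
    (hV : ∀ A ∈ V.carrier, ∀ a b : A, f.realize ![a, b] = a)
    (hA : A ∈ V.regularization.carrier) {n : ℕ} (F : L.Functions n) {x : Fin n → A} {b : A}
    (hx : ∀ i, f.realize ![b, x i] = b) :
    f.realize ![b, Structure.funMap F x] = b := by
  have : Nonempty A := ⟨b⟩
  classical
  -- Inserting b beside each argument lets `hx` turn the arguments into b, leaving f(b, F(b,…,b)) ≈
  -- b.
  have h := realize_eq_of_mem_regularization hA
    (s := binary f (Term.var b) (Term.func F fun i => Term.var (x i)))
    (t := binary f (Term.var b)
      (Term.func F fun i => binary f (Term.var b) (Term.var (x i))))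
    (by
      ext
      simp only [mem_varFinset_binary hf, mem_varFinset_func, exists_or]
      grind)
    (fun B hB v => by simp only [realize_binary, hV B hB]) id
  have h' := realize_eq_of_mem_regularization hA
    (s := binary f (Term.var b) (Term.func F fun _ => Term.var b)) (t := Term.var b)
    (by
      ext
      simp only [mem_varFinset_binary hf, mem_varFinset_func]
      grind)
    (fun B hB v => by simp only [realize_binary, hV B hB]) id
  simp only [realize_binary, Term.realize_var, Term.realize_func, id, hx] at h h'
  exact h.trans h'

/-- The subalgebra of the elements whose Płonka fiber lies below that of `b`. -/
def lowerSubstructure (hf : f.varFinset = Finset.univ)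
    (hV : ∀ A ∈ V.carrier, ∀ a b : A, f.realize ![a, b] = a)
    (hA : A ∈ V.regularization.carrier) (b : A) : L.Substructure A where
  carrier := {x | f.realize ![b, x] = b}
  fun_mem F _ hx := realize_funMap_left hf hV hA F hx

/-- The algebra on the Płonka fiber of `b`: every operation is followed by `x ↦ f(x, b)`. -/
def fiber (hf : f.varFinset = Finset.univ)
    (hV : ∀ A ∈ V.carrier, ∀ a b : A, f.realize ![a, b] = a)
    (hA : A ∈ V.regularization.carrier) (b : A) : Alg.{u, v, w} L where
  α := {x : A // f.realize ![x, b] = x ∧ f.realize ![b, x] = b}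
  str :=
    -- The correction by f(·, b) matters only for constants, which may lie outside the fiber.
    { funMap := fun F x => ⟨f.realize ![Structure.funMap F fun i => (x i).1, b],
        realize_right_idem hf hV hA _ _, by
          rw [realize_absorb hf hV hA]
          exact realize_funMap_left hf hV hA F fun i => (x i).2.2⟩
      RelMap := fun _ _ => True }

/-- The retraction `x ↦ f(x, b)` onto the fiber of `b`. -/
def fiberHom [L.IsAlgebraic] (hf : f.varFinset = Finset.univ)
    (hV : ∀ A ∈ V.carrier, ∀ a b : A, f.realize ![a, b] = a)
    (hA : A ∈ V.regularization.carrier) (b : A) :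
    lowerSubstructure hf hV hA b →[L] fiber hf hV hA b where
  toFun x := ⟨f.realize ![x.1, b], realize_right_idem hf hV hA _ _,
    (realize_absorb hf hV hA _ _).trans x.2⟩
  map_fun' F x := Subtype.ext (realize_funMap_right hf hV hA F (fun i => (x i).1) b).symm
  map_rel' r := isEmptyElim r

theorem fiberHom_surjective [L.IsAlgebraic] (hf : f.varFinset = Finset.univ)
    (hV : ∀ A ∈ V.carrier, ∀ a b : A, f.realize ![a, b] = a)
    (hA : A ∈ V.regularization.carrier) (b : A) :
    Function.Surjective (fiberHom hf hV hA b) :=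
  fun y => ⟨⟨y.1, y.2.2⟩, Subtype.ext y.2.1⟩

theorem realize_fiberHom [L.IsAlgebraic] (hf : f.varFinset = Finset.univ)
    (hV : ∀ A ∈ V.carrier, ∀ a b : A, f.realize ![a, b] = a)
    (hA : A ∈ V.regularization.carrier) (b : A) {α : Type*} (t : L.Term α)
    (a : α → lowerSubstructure hf hV hA b) :
    (t.realize fun k => fiberHom hf hV hA b (a k)).1 =
      f.realize ![t.realize fun k => (a k).1, b] := by
  have h := HomClass.realize_term (fiberHom hf hV hA b) (t := t) (v := a)
  have h' := HomClass.realize_term (lowerSubstructure hf hV hA b).subtype (t := t) (v := a)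
  refine (congrArg Subtype.val h).trans ?_
  change f.realize ![((t.realize a : lowerSubstructure hf hV hA b) : A), b] = _
  congr 2
  exact h'.symm

theorem fiber_mem [L.IsAlgebraic] (hf : f.varFinset = Finset.univ)
    (hV : ∀ A ∈ V.carrier, ∀ a b : A, f.realize ![a, b] = a)
    (hA : A ∈ V.regularization.carrier) {U : Variety.{u, v, w} L} (hAU : A ∈ U.carrier) (b : A) :
    fiber hf hV hA b ∈ U.carrier :=
  U.hom_closed _ (U.sub_closed A hAU (lowerSubstructure hf hV hA b)) _ (fiberHom hf hV hA b)
    (fiberHom_surjective hf hV hA b)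

/-- The fiber is in R(V), so f(x,y) ≈ x suffices; there `realize_cancel` removes y, because f(b,y) =
b. -/
theorem fiber_mem_base [L.IsAlgebraic] (hf : f.varFinset = Finset.univ)
    (hV : ∀ A ∈ V.carrier, ∀ a b : A, f.realize ![a, b] = a)
    (hA : A ∈ V.regularization.carrier) (b : A) : fiber hf hV hA b ∈ V.carrier := by
  have : Nonempty (fiber hf hV hA b) :=
    ⟨⟨b, realize_self hf hV hA b, realize_self hf hV hA b⟩⟩
  refine mem_of_mem_regularization hf hV (fiber_mem hf hV hA hA b) fun x y => ?_
  obtain ⟨x, rfl⟩ := fiberHom_surjective hf hV hA b x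
  obtain ⟨y, rfl⟩ := fiberHom_surjective hf hV hA b y
  apply Subtype.ext
  have h := realize_fiberHom hf hV hA b f ![x, y]
  have hl : (fun k => fiberHom hf hV hA b (![x, y] k)) =
      ![fiberHom hf hV hA b x, fiberHom hf hV hA b y] := by
    funext k
    fin_cases k <;> rfl
  have hr : (fun k => ((![x, y] k : lowerSubstructure hf hV hA b) : A)) = ![x.1, y.1] := by
    funext k
    fin_cases k <;> rfl
  rw [hl, hr] at h
  refine h.trans ?_
  have hy : f.realize ![b, y.1] = b := y.2
  have hc := realize_cancel hf hV hA x.1 y.1 b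
  rwa [hy] at hc

end Fiber

/-- A regular identity holds in an algebra of the regularization as soon as it holds in its
Płonka fibers. -/
theorem holdsIn_of_fibers [L.IsAlgebraic] (hf : f.varFinset = Finset.univ)
    (hV : ∀ A ∈ V.carrier, ∀ a b : A, f.realize ![a, b] = a) {A : Alg.{u, v, w} L}
    (hA : A ∈ V.regularization.carrier) {e : Identity L} (he : e.IsRegular)
    (h : ∀ b : A, e.HoldsIn (fiber hf hV hA b)) : e.HoldsIn A := by
  intro a
  -- The fiber of the value of the left side lies above all the values used: f(lhs, xₙ) ≈ lhs is
  -- regular. Unused variables are sent to b.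
  set b := e.lhs.realize a with hb
  let a' : ℕ → A := fun n => if n ∈ e.lhs.varFinset then a n else b
  have ha' : ∀ n, f.realize ![b, a' n] = b := by
    intro n
    by_cases hn : n ∈ e.lhs.varFinset
    · have key := realize_eq_of_mem_regularization hA (s := binary f e.lhs (Term.var n))
        (t := e.lhs)
        (by
          ext x
          simp only [mem_varFinset_binary hf, mem_varFinset_var]
          grind)
        (fun B hB v => realize_binary_of_mem hV _ _ hB v) a
      simp only [a', if_pos hn]
      simpa only [realize_binary, Term.realize_var] using key
    · simp only [a', if_neg hn]
      exact realize_self hf hV hA b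
  have hl : e.lhs.realize a' = b :=
    realize_eq_of_eqOn _ fun x hx => by simp only [a', if_pos hx]
  have hr : e.rhs.realize a' = e.rhs.realize a :=
    realize_eq_of_eqOn _ fun x hx => by
      have hx' : x ∈ e.lhs.varFinset := he ▸ hx
      simp only [a', if_pos hx']
  have key := congrArg Subtype.val
    (h b fun n => fiberHom hf hV hA b ⟨a' n, ha' n⟩)
  rw [realize_fiberHom hf hV hA b e.lhs fun n => ⟨a' n, ha' n⟩,
    realize_fiberHom hf hV hA b e.rhs fun n => ⟨a' n, ha' n⟩] at key
  change f.realize ![e.lhs.realize a', b] = f.realize ![e.rhs.realize a', b] at key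
  rw [hl, hr, realize_self hf hV hA] at key
  -- The fiber yields b = f(rhs, b); regularity of the identity now removes b.
  have h2 := realize_eq_of_mem_regularization hA (s := binary f e.rhs e.lhs) (t := e.rhs)
    (by
      ext x
      rw [mem_varFinset_binary hf, he, or_self])
    (fun B hB v => realize_binary_of_mem hV _ _ hB v) a
  rw [realize_binary, ← hb] at h2
  exact key.trans h2

/-! ### Subvarieties of the regularization and the isomorphism. -/

/-- A constant excludes the empty algebra, where all identities hold vacuously. -/
theorem nonempty_alg [Nonempty L.Constants] (A : Alg.{u, v, w} L) : Nonempty A :=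
  ⟨((Classical.arbitrary L.Constants : L.Constants) : A)⟩

/-- A subvariety of the regularization not contained in `V` satisfies only regular identities. -/
theorem isRegular_of_not_le [L.IsAlgebraic] [Nonempty L.Constants]
    (hf : f.varFinset = Finset.univ)
    (hV : ∀ A ∈ V.carrier, ∀ a b : A, f.realize ![a, b] = a)
    {U : Variety.{u, v, w} L} (hU : U ≤ V.regularization) (hUV : ¬ U ≤ V) {e : Identity L}
    (he : U.Satisfies e) : e.IsRegular := by
  by_contra hreg
  refine hUV fun A hA => ?_
  have := nonempty_alg A
  refine mem_of_mem_regularization hf hV (hU hA) fun a b => ?_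
  have : ∃ n, ¬ (n ∈ e.lhs.varFinset ↔ n ∈ e.rhs.varFinset) := by
    by_contra! h
    exact hreg (Finset.ext h)
  obtain ⟨n, hn⟩ := this
  by_cases hl : n ∈ e.lhs.varFinset
  · exact realize_eq_left_of_irregular hf hV (hU hA) (he A hA) hl (by tauto) a b
  · exact realize_eq_left_of_irregular hf hV (hU hA) (fun a => (he A hA a).symm)
      (s := e.rhs) (by tauto) hl a b

theorem eq_regularization_of_not_le [L.IsAlgebraic] [Nonempty L.Constants]
    (hf : f.varFinset = Finset.univ)
    (hV : ∀ A ∈ V.carrier, ∀ a b : A, f.realize ![a, b] = a)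
    {U : Variety.{u, v, w} L} (hU : U ≤ V.regularization) (hUV : ¬ U ≤ V) :
    (U ⊓ V).regularization = U := by
  apply le_antisymm
  · intro A hA
    have := nonempty_alg A
    refine U.mem_of_identities A fun e he => hA e ⟨isRegular_of_not_le hf hV hU hUV he, ?_⟩
    exact fun B hB => he B ((inf_le_left : U ⊓ V ≤ U) hB)
  · intro A hA e he
    refine holdsIn_of_fibers hf hV (hU hA) he.1 fun b => he.2 _ ?_
    -- The meet is the intersection over the pair {U, V}.
    rintro W (rfl | rfl)
    · exact fiber_mem hf hV (hU hA) hA b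
    · exact fiber_mem_base hf hV (hU hA) b

theorem le_of_le_regularization [L.IsAlgebraic] [Nonempty L.Constants]
    (hf : f.varFinset = Finset.univ)
    (hV : ∀ A ∈ V.carrier, ∀ a b : A, f.realize ![a, b] = a)
    {W W' : Variety.{u, v, w} L} (hW : W ≤ V) (hW' : W' ≤ V) (h : W ≤ W'.regularization) :
    W ≤ W' := fun A hA =>
  have := nonempty_alg A
  mem_of_mem_regularization hf (fun B hB => hV B (hW' hB)) (h hA) (hV A (hW hA))

/-- The map `(W, 0) ↦ W`, `(W, 1) ↦ R(W)`. -/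
def regularizationMap (V : Variety.{u, v, w} L) (p : V.Subvarieties × Fin 2) :
    V.regularization.Subvarieties :=
  if p.2 = 0 then ⟨p.1, p.1.2.trans V.le_regularization⟩
  else ⟨p.1.1.regularization, regularization_mono p.1.2⟩

theorem regularizationMap_le_iff [L.IsAlgebraic] [Nonempty L.Constants]
    (hf : f.varFinset = Finset.univ)
    (hV : ∀ A ∈ V.carrier, ∀ a b : A, f.realize ![a, b] = a) (p q : V.Subvarieties × Fin 2) :
    regularizationMap V p ≤ regularizationMap V q ↔ p ≤ q := by
  obtain ⟨⟨W, hW⟩, i⟩ := p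
  obtain ⟨⟨W', hW'⟩, j⟩ := q
  have back : W ≤ W'.regularization → W ≤ W' := le_of_le_regularization hf hV hW hW'
  fin_cases i <;> fin_cases j
  · change W ≤ W' ↔ W ≤ W' ∧ (0 : Fin 2) ≤ 0
    simp
  · change W ≤ W'.regularization ↔ W ≤ W' ∧ (0 : Fin 2) ≤ 1
    exact ⟨fun h => ⟨back h, by decide⟩, fun h => h.1.trans W'.le_regularization⟩
  · change W.regularization ≤ W' ↔ W ≤ W' ∧ (1 : Fin 2) ≤ 0
    refine ⟨fun h => ?_, fun h => absurd h.2 (by decide)⟩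
    exact absurd (hW' (h W.semilattice_mem_regularization)) (semilattice_notMem hf hV)
  · change W.regularization ≤ W'.regularization ↔ W ≤ W' ∧ (1 : Fin 2) ≤ 1
    exact ⟨fun h => ⟨back (W.le_regularization.trans h), le_rfl⟩,
      fun h => regularization_mono h.1⟩

theorem regularizationMap_surjective [L.IsAlgebraic] [Nonempty L.Constants]
    (hf : f.varFinset = Finset.univ)
    (hV : ∀ A ∈ V.carrier, ∀ a b : A, f.realize ![a, b] = a) :
    Function.Surjective (regularizationMap V) := by
  rintro ⟨U, hU⟩
  by_cases hUV : U ≤ V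
  · exact ⟨(⟨U, hUV⟩, 0), Subtype.ext rfl⟩
  · exact ⟨(⟨U ⊓ V, (inf_le_right : U ⊓ V ≤ V)⟩, 1), Subtype.ext (eq_regularization_of_not_le hf hV hU hUV)⟩

end Variety

end UniversalAlgebra

theorem mainTheorem4 (L : FirstOrder.Language.{u, v}) [L.IsAlgebraic] [Nonempty L.Constants]
    (V : UniversalAlgebra.Variety.{u, v, w} L) (hV : V.IsStronglyIrregular) :
    ∃ φ : V.Subvarieties × Fin 2 ≃o V.regularization.Subvarieties,
      ∀ W : V.Subvarieties,
        (φ (W, 0) : UniversalAlgebra.Variety.{u, v, w} L) = W ∧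
        (φ (W, 1) : UniversalAlgebra.Variety.{u, v, w} L) = W.1.regularization := by
  obtain ⟨f, hf, hV⟩ := hV
  exact ⟨RelIso.ofSurjective
    (OrderEmbedding.ofMapLEIff (UniversalAlgebra.Variety.regularizationMap V)
      (UniversalAlgebra.Variety.regularizationMap_le_iff hf hV))
    (UniversalAlgebra.Variety.regularizationMap_surjective hf hV), fun W => ⟨rfl, rfl⟩⟩
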